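/- A \emph{contact-segment graph} is a finite simple graph $G$ that has a \emph{segment contact representation}: a family $(D_v)_{v\in V(G)}$ of closed straight-line segments in the Euclidean plane (segments of length zero being allowed) such that two distinct vertices $u,v$ are adjacent in $G$ if and only if $D_u\cap D_v\neq\emptyset$, and such that, for any two distinct vertices $u,v$, every point of $D_u\cap D_v$ is an endpoint of at least one of $D_u$, $D_v$. A class $\mathcal G$ of graphs has \emph{linear neighborhood complexity} if there is a constant $c$ such that, for every $G\in\mathcal G$ and every nonempty set $X\subseteq V(G)$, $$\bigl|\{N(v)\cap X : v\in V(G)\}\bigr|\le c\,|X|,$$ where $N(v)$ denotes the (open) neighborhood of $v$ in $G$. \textbf{Lemma.} The class of contact-segment graphs has linear neighborhood complexity. -/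

import Mathlib

universe u

/-- The Euclidean plane. -/
abbrev Plane : Type := EuclideanSpace ℝ (Fin 2)

/-- A contact representation of a graph `G` by closed straight-line segments of the plane: the vertex
`v` is represented by the segment with endpoints `p v` and `q v` (possibly of length zero). -/
structure SegmentContactRepresentation {V : Type u} (G : SimpleGraph V) where
  /-- first endpoint of the segment of a vertex -/
  p : V → Plane
  /-- second endpoint of the segment of a vertex -/
  q : V → Plane
  /-- distinct vertices are adjacent exactly when their segments intersect -/
  adj_iff : ∀ u v : V, u ≠ v →
    (G.Adj u v ↔ (segment ℝ (p u) (q u) ∩ segment ℝ (p v) (q v)).Nonempty)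
  /-- a point that belongs to the segments of two distinct vertices is an endpoint of at least one
  of these two segments -/
  contact : ∀ u v : V, u ≠ v → ∀ x : Plane,
    x ∈ segment ℝ (p u) (q u) → x ∈ segment ℝ (p v) (q v) →
      (x = p u ∨ x = q u) ∨ (x = p v ∨ x = q v)

/-- Contact-segment graphs: the graphs that have a segment contact representation. -/
def IsContactSegmentGraph (V : Type u) (G : SimpleGraph V) : Prop :=
  Nonempty (SegmentContactRepresentation G)

/-- The class `𝒢` of graphs has linear neighborhood complexity with ratio `c`: for every finite
graph `G` of `𝒢` and every nonempty set `X` of vertices, the sets `N(v) ∩ X`, for `v` a vertex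
of `G` (in `X` or not), are at most `c * |X|` in number. -/
def HasLinearNeighborhoodComplexityWithRatio
    (𝒢 : (V : Type u) → SimpleGraph V → Prop) (c : ℝ) : Prop :=
  ∀ (V : Type u) [Finite V] (G : SimpleGraph V), 𝒢 V G →
    ∀ X : Set V, X.Nonempty →
      ((Set.range fun v : V => G.neighborSet v ∩ X).ncard : ℝ) ≤ c * (X.ncard : ℝ)

/-- The class `𝒢` of graphs has linear neighborhood complexity: the ratio is a constant that
depends only on `𝒢`. -/
def HasLinearNeighborhoodComplexity (𝒢 : (V : Type u) → SimpleGraph V → Prop) : Prop :=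
  ∃ c : ℝ, HasLinearNeighborhoodComplexityWithRatio 𝒢 c

/-!
Let `n = |X|`, and call *tips* the endpoints of the segments of `X`. The neighborhoods of the `n`
vertices of `X` and of the vertices whose segment has a tip in its relative interior need no
care: by the contact condition a tip is in the relative interior of at most one segment, so there
are at most `2n` of the latter. Any other segment meets the segments of `X` at its two ends only,
so its trace on `X` is the union of the traces of two points. A point is either a tip or on at most
one segment of `X`; its `PointKind` records the tip or the segment and determines its trace. There
are `O(n)` kinds, and what has to be shown is that the *connectors*, the segments that join
two points of different kinds, realize only `O(n)` unordered pairs of kinds.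

This is an instance of the linear bound for planar graphs, proved here by a sweep. After a generic
shear (`exists_injOn_abscissa`) distinct endpoints have distinct abscissas, and a segment of
positive length is the graph of an affine function; only continuity and the absence of crossings
matter (`Arrangement`). A vertical line reads a word of curves from bottom to top. A segment of `X`
is labelled by itself, a connector by the kind of its left end. The `potential` of the word is the
number of pairs of kinds that are realized by connectors left of the line, or consist of the
labels of two neighbours at least one of which is in `X`, plus the number of changes of labels
between neighbours; the pairs `s(k, k)` with `k` the interior of a segment of `X` always count as
realized.

When the line passes a point in the relative interior of a segment `x` of `X`, connectors next
to `x` end on `x` and are deleted, and connectors labelled `x` are inserted next to `x`. The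
deletion of a connector creates a new pair only if its label differs from that of the next letter,
and then a change of labels is lost: the potential does not grow (`potential_exchange_le`). When the
line passes a tip, the potential grows by at most a constant plus a multiple of the number of
segments of `X` that start there (`potential_replace_le`). Hence the potential remains
`O(n)` (`Arrangement.exists_word_potential_le`), and it bounds the number of pairs realized by
connectors (`Arrangement.card_image_kinds_le`).
-/

/-! ### Words of labelled letters -/

section Words

open Classical

/-- The number of pairs of consecutive letters of a word that carry different labels. -/
noncomputable def labelChanges {α T : Type*} (lab : α → T) : List α → ℕ
  | [] => 0
  | [_] => 0
  | a :: b :: w => (if lab a = lab b then 0 else 1) + labelChanges lab (b :: w)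

/-- The unordered pairs of labels of consecutive letters of a word, at least one of which is
*special*, that is, satisfies `K`. -/
noncomputable def labelContacts {α T : Type*} (lab : α → T) (K : α → Prop) :
    List α → Finset (Sym2 T)
  | [] => ∅
  | [_] => ∅
  | a :: b :: w =>
      (if K a ∨ K b then {s(lab a, lab b)} else ∅) ∪ labelContacts lab K (b :: w)

/-- The potential of a word relative to a set `D` of pairs already accounted for. -/
noncomputable def potential {α T : Type*} (lab : α → T) (K : α → Prop) (D : Finset (Sym2 T))
    (w : List α) : ℕ :=
  (D ∪ labelContacts lab K w).card + labelChanges lab w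

variable {α T : Type*} (lab : α → T) (K : α → Prop)

theorem labelChanges_append_cons (A : List α) (a : α) (C : List α) :
    labelChanges lab (A ++ a :: C) = labelChanges lab (A ++ [a]) + labelChanges lab (a :: C) := by
  induction A with
  | nil => simp [labelChanges]
  | cons b A ih =>
    cases A with
    | nil => simp [labelChanges]
    | cons c A => simp only [List.cons_append, labelChanges] at ih ⊢; omega

theorem labelContacts_append_cons (A : List α) (a : α) (C : List α) :
    labelContacts lab K (A ++ a :: C) =
      labelContacts lab K (A ++ [a]) ∪ labelContacts lab K (a :: C) := by
  induction A with
  | nil => simp [labelContacts]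
  | cons b A ih =>
    cases A with
    | nil => simp [labelContacts]
    | cons c A =>
      simp only [List.cons_append, labelContacts] at ih ⊢
      rw [ih, Finset.union_assoc]

theorem labelChanges_reverse (w : List α) :
    labelChanges lab w.reverse = labelChanges lab w := by
  induction w with
  | nil => rfl
  | cons a w ih =>
    cases w with
    | nil => rfl
    | cons b w =>
      rw [List.reverse_cons, List.reverse_cons, List.append_assoc, List.singleton_append,
        labelChanges_append_cons, ← List.reverse_cons, ih]
      have h : lab b = lab a ↔ lab a = lab b := eq_comm
      simp only [labelChanges, h]
      omega

theorem labelContacts_reverse (w : List α) :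
    labelContacts lab K w.reverse = labelContacts lab K w := by
  induction w with
  | nil => rfl
  | cons a w ih =>
    cases w with
    | nil => rfl
    | cons b w =>
      rw [List.reverse_cons, List.reverse_cons, List.append_assoc, List.singleton_append,
        labelContacts_append_cons, ← List.reverse_cons, ih]
      simp only [labelContacts, Finset.union_empty, Sym2.eq_swap (a := lab b), or_comm (a := K b)]
      rw [Finset.union_comm]

theorem potential_reverse (D : Finset (Sym2 T)) (w : List α) :
    potential lab K D w.reverse = potential lab K D w := by
  rw [potential, potential, labelChanges_reverse, labelContacts_reverse]

variable {lab K}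

theorem potential_mono {D D' : Finset (Sym2 T)} (h : D ⊆ D') (w : List α) :
    potential lab K D w ≤ potential lab K D' w := by
  unfold potential
  gcongr

/-- If the letter `u` next to a special letter `x` is deleted, then the letter `n` that takes its
place may create the new contact `s(lab x, lab n)`; this happens only if `u` and `n` have different
labels, and then one change of labels disappears. -/
theorem potential_delete_le (D : Finset (Sym2 T)) (A C : List α) {x u : α}
    (hx : K x) (hu : lab u ≠ lab x) :
    potential lab K (insert s(lab u, lab x) D) (A ++ x :: C) ≤
      potential lab K D (A ++ x :: u :: C) := by
  unfold potential
  rw [labelChanges_append_cons lab A x C, labelChanges_append_cons lab A x (u :: C),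
    labelContacts_append_cons lab K A x C, labelContacts_append_cons lab K A x (u :: C)]
  cases C with
  | nil =>
    simp only [labelChanges, labelContacts, hx, true_or, if_true, if_neg hu.symm]
    have key : insert s(lab u, lab x) D ∪ (labelContacts lab K (A ++ [x]) ∪ ∅) ⊆
        D ∪ (labelContacts lab K (A ++ [x]) ∪ ({s(lab x, lab u)} ∪ ∅)) := by
      rw [Sym2.eq_swap]; intro e; simp
    have := Finset.card_le_card key
    omega
  | cons n C =>
    simp only [labelChanges, labelContacts, hx, true_or, if_true, if_neg hu.symm]
    set S := labelContacts lab K (A ++ [x])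
    set S' := labelContacts lab K (n :: C)
    by_cases hn : lab u = lab n
    · have : insert s(lab u, lab x) D ∪ (S ∪ ({s(lab x, lab n)} ∪ S')) ⊆
          D ∪ (S ∪ ({s(lab x, lab u)} ∪
            ((if K u ∨ K n then {s(lab u, lab n)} else ∅) ∪ S'))) := by
        rw [← hn, Sym2.eq_swap (a := lab u) (b := lab x)]; intro e; simp; tauto
      have := Finset.card_le_card this
      split_ifs at * <;> omega
    · have : insert s(lab u, lab x) D ∪ (S ∪ ({s(lab x, lab n)} ∪ S')) ⊆
          insert s(lab x, lab n) (D ∪ (S ∪ ({s(lab x, lab u)} ∪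
            ((if K u ∨ K n then {s(lab u, lab n)} else ∅) ∪ S')))) := by
        rw [Sym2.eq_swap (a := lab u) (b := lab x)]; intro e; simp; tauto
      have := (Finset.card_le_card this).trans (Finset.card_insert_le _ _)
      rw [if_neg hn]
      split_ifs at * <;> omega

/-- A new letter with the label of its special neighbour `x` creates no change of labels, and no
contact other than the pair of `lab x` with itself. -/
theorem potential_insert_le (D : Finset (Sym2 T)) (A C : List α) {x u : α}
    (hx : K x) (hu : lab u = lab x) (hD : s(lab x, lab x) ∈ D) :
    potential lab K D (A ++ x :: u :: C) ≤ potential lab K D (A ++ x :: C) := by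
  unfold potential
  rw [labelChanges_append_cons lab A x C, labelChanges_append_cons lab A x (u :: C),
    labelContacts_append_cons lab K A x C, labelContacts_append_cons lab K A x (u :: C)]
  have key : D ∪ (labelContacts lab K (A ++ [x]) ∪ labelContacts lab K (x :: u :: C)) ⊆
      D ∪ (labelContacts lab K (A ++ [x]) ∪ labelContacts lab K (x :: C)) := by
    cases C with
    | nil =>
      intro e
      have hD' : e = s(lab x, lab x) → e ∈ D := fun h => h ▸ hD
      simp only [labelContacts, hx, hu, true_or, if_true, Finset.mem_union, Finset.mem_singleton,
        Finset.notMem_empty, or_false]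
      tauto
    | cons n C =>
      intro e
      have hD' : e = s(lab x, lab x) → e ∈ D := fun h => h ▸ hD
      simp only [labelContacts, hx, hu, true_or, if_true, Finset.mem_union, Finset.mem_singleton]
      split_ifs
      · simp only [Finset.mem_singleton]; tauto
      · simp only [Finset.notMem_empty]; tauto
  have := Finset.card_le_card key
  have h2 : labelChanges lab (x :: u :: C) = labelChanges lab (x :: C) := by
    cases C <;> simp [labelChanges, hu]
  omega

theorem potential_delete_right_le (A C : List α) {x : α} (hx : K x)
    (us : List α) (hu : ∀ u ∈ us, lab u ≠ lab x) (D : Finset (Sym2 T)) :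
    potential lab K (D ∪ (us.map fun u => s(lab u, lab x)).toFinset) (A ++ x :: C) ≤
      potential lab K D (A ++ x :: (us ++ C)) := by
  induction us generalizing D with
  | nil => simp
  | cons u us ih =>
    refine le_trans ?_ (potential_delete_le D A (us ++ C) hx (hu u (by simp)))
    refine le_trans (potential_mono ?_ _)
      (ih (fun v hv => hu v (by simp [hv])) (insert s(lab u, lab x) D))
    intro e; simp

theorem potential_insert_right_le (A C : List α) {x : α} (hx : K x) (us : List α)
    (hu : ∀ u ∈ us, lab u = lab x) (D : Finset (Sym2 T)) (hD : s(lab x, lab x) ∈ D) :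
    potential lab K D (A ++ x :: (us ++ C)) ≤ potential lab K D (A ++ x :: C) := by
  induction us with
  | nil => simp
  | cons u us ih =>
    exact (potential_insert_le D A (us ++ C) hx (hu u (by simp)) hD).trans
      (ih fun v hv => hu v (by simp [hv]))

/-- Around a special letter `x`, neighbours with labels other than that of `x` are deleted and
neighbours with the label of `x` are inserted: the potential does not grow, even though the pairs
formed by the labels of the deleted letters and of `x` are added to `D`. -/
theorem potential_exchange_le (A C a₁ a₂ d₁ d₂ : List α) {x : α} (hx : K x)
    (h₁ : ∀ u ∈ a₁, lab u ≠ lab x) (h₂ : ∀ u ∈ a₂, lab u ≠ lab x)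
    (k₁ : ∀ u ∈ d₁, lab u = lab x) (k₂ : ∀ u ∈ d₂, lab u = lab x)
    (D : Finset (Sym2 T)) (hD : s(lab x, lab x) ∈ D) :
    potential lab K (D ∪ ((a₁ ++ a₂).map fun u => s(lab u, lab x)).toFinset)
      (A ++ (d₁ ++ x :: d₂) ++ C) ≤ potential lab K D (A ++ (a₁ ++ x :: a₂) ++ C) := by
  set D₂ := D ∪ (a₂.map fun u => s(lab u, lab x)).toFinset with hD₂
  set D₁ := D₂ ∪ (a₁.reverse.map fun u => s(lab u, lab x)).toFinset with hD₁
  have e : D ∪ ((a₁ ++ a₂).map fun u => s(lab u, lab x)).toFinset = D₁ := by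
    rw [hD₁, hD₂]; ext e; simp [or_comm]
  have hDD : s(lab x, lab x) ∈ D₁ := by simp [hD₁, hD₂, hD]
  have s₁ := potential_delete_right_le (A ++ a₁) C hx a₂ h₂ D
  have s₂ := potential_delete_right_le C.reverse A.reverse hx a₁.reverse (by simpa using h₁) D₂
  have s₃ := potential_insert_right_le C.reverse A.reverse hx d₁.reverse (by simpa using k₁) D₁ hDD
  have s₄ := potential_insert_right_le (A ++ d₁) C hx d₂ k₂ D₁ hDD
  rw [← potential_reverse, ← potential_reverse lab K D₂] at s₂
  rw [← potential_reverse, ← potential_reverse lab K D₁ (C.reverse ++ x :: A.reverse)] at s₃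
  simp only [List.reverse_append, List.reverse_cons, List.reverse_reverse, List.append_assoc,
    List.cons_append, List.nil_append] at s₁ s₂ s₃ s₄
  rw [e]
  simp only [List.append_assoc, List.cons_append]
  exact s₄.trans (s₃.trans (s₂.trans s₁))

theorem labelChanges_add_le (A B : List α) :
    labelChanges lab A + labelChanges lab B ≤ labelChanges lab (A ++ B) := by
  cases B with
  | nil => simp [labelChanges]
  | cons b B =>
    rw [labelChanges_append_cons]
    gcongr
    induction A with
    | nil => simp [labelChanges]
    | cons a A ih =>
      cases A with
      | nil => simp [labelChanges]
      | cons c A => simp only [List.cons_append, labelChanges] at ih ⊢; omega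

theorem labelChanges_append_le (A B : List α) :
    labelChanges lab (A ++ B) ≤ labelChanges lab A + labelChanges lab B + 1 := by
  induction A with
  | nil => simp [labelChanges]
  | cons a A ih =>
    cases A with
    | nil =>
      cases B with
      | nil => simp [labelChanges]
      | cons b B => simp only [List.cons_append, List.nil_append, labelChanges]; split_ifs <;> omega
    | cons c A => simp only [List.cons_append, labelChanges] at ih ⊢; omega

theorem labelContacts_subset_append_left (A B : List α) :
    labelContacts lab K A ⊆ labelContacts lab K (A ++ B) := by
  induction A with
  | nil => simp [labelContacts]
  | cons a A ih =>
    cases A with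
    | nil => simp [labelContacts]
    | cons c A =>
      simp only [List.cons_append, labelContacts] at ih ⊢
      exact Finset.union_subset_union_right ih

theorem labelContacts_subset_append_right (A B : List α) :
    labelContacts lab K B ⊆ labelContacts lab K (A ++ B) := by
  cases B with
  | nil => simp [labelContacts]
  | cons b B => rw [labelContacts_append_cons]; exact Finset.subset_union_right

theorem labelContacts_append_subset (A B : List α) :
    ∃ E : Finset (Sym2 T), E.card ≤ 1 ∧
      labelContacts lab K (A ++ B) ⊆ labelContacts lab K A ∪ labelContacts lab K B ∪ E := by
  induction A with
  | nil => exact ⟨∅, by simp, by simp⟩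
  | cons a A ih =>
    cases A with
    | nil =>
      cases B with
      | nil => exact ⟨∅, by simp, by simp⟩
      | cons b B =>
        refine ⟨{s(lab a, lab b)}, by simp, ?_⟩
        simp only [List.cons_append, List.nil_append, labelContacts]
        split_ifs <;> simp
    | cons c A =>
      obtain ⟨E, hE, h⟩ := ih
      refine ⟨E, hE, ?_⟩
      simp only [List.cons_append, labelContacts] at h ⊢
      rw [Finset.union_assoc, Finset.union_assoc]
      refine Finset.union_subset_union_right (h.trans ?_)
      rw [Finset.union_assoc]

theorem card_toFinset_map_le_labelChanges (t : T) (w : List α) :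
    (w.map fun u => s(lab u, t)).toFinset.card ≤ labelChanges lab w + 1 := by
  induction w with
  | nil => simp
  | cons a w ih =>
    cases w with
    | nil => simp [labelChanges]
    | cons b w =>
      rw [List.map_cons, List.toFinset_cons, labelChanges]
      split_ifs with h
      · rw [Finset.insert_eq_of_mem (by simp [h])]; omega
      · have := Finset.card_insert_le s(lab a, t)
          (List.map (fun u => s(lab u, t)) (b :: w)).toFinset
        omega

/-- In a word whose letters are special or carry the label `t`, every change of labels involves a
special letter. -/
theorem labelChanges_le_of_label_eq [DecidablePred K] (t : T) (w : List α)
    (h : ∀ u ∈ w, ¬ K u → lab u = t) :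
    labelChanges lab w ≤ 2 * w.countP (K ·) := by
  -- The first letter has no predecessor: the strengthening by one lets the induction go through.
  suffices H : ∀ w : List α, (∀ u ∈ w, ¬ K u → lab u = t) →
      labelChanges lab w + (if ∃ a ∈ w.head?, K a then 1 else 0) ≤ 2 * w.countP (K ·) by
    have := H w h; omega
  intro w h
  induction w with
  | nil => simp [labelChanges]
  | cons a w ih =>
    have ih := ih fun u hu => h u (by simp [hu])
    cases w with
    | nil => by_cases ha : K a <;> simp [labelChanges, ha]
    | cons b w =>
      rw [List.countP_cons]
      simp only [labelChanges, List.head?_cons, Option.mem_some_iff, exists_eq_left',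
        decide_eq_true_eq] at ih ⊢
      by_cases ha : K a <;> by_cases hb : K b
      · simp only [ha, hb, if_true] at ih ⊢; split_ifs <;> omega
      · simp only [ha, hb, if_true, if_false] at ih ⊢; split_ifs <;> omega
      · simp only [ha, hb, if_true, if_false] at ih ⊢; split_ifs <;> omega
      · rw [if_pos ((h a (by simp) ha).trans (h b (by simp) hb).symm)]
        simp only [ha, hb, if_false] at ih ⊢; omega

theorem card_labelContacts_le [DecidablePred K] (w : List α) :
    (labelContacts lab K w).card ≤ 2 * w.countP (K ·) := by
  suffices H : ∀ w : List α,
      (labelContacts lab K w).card + (if ∃ a ∈ w.head?, K a then 1 else 0) ≤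
        2 * w.countP (K ·) by
    have := H w; omega
  intro w
  induction w with
  | nil => simp [labelContacts]
  | cons a w ih =>
    cases w with
    | nil => by_cases ha : K a <;> simp [labelContacts, ha]
    | cons b w =>
      rw [List.countP_cons]
      simp only [labelContacts, List.head?_cons, Option.mem_some_iff, exists_eq_left',
        decide_eq_true_eq] at ih ⊢
      have := Finset.card_union_le ({s(lab a, lab b)} : Finset (Sym2 T))
        (labelContacts lab K (b :: w))
      rw [Finset.card_singleton] at this
      by_cases ha : K a <;> by_cases hb : K b <;>
        simp only [ha, hb, true_or, or_true, or_self, if_true, if_false, Finset.empty_union]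
          at ih ⊢ <;> omega

/-- An arbitrary factor `M` is replaced by a factor `M'` whose letters are special or have the
label `t`. Each change of labels in `M` pays for a new pair formed with `t`, hence the cost depends
only on the number of special letters of `M'`. -/
theorem potential_replace_le [DecidablePred K] (t : T) (A C M M' : List α)
    (h : ∀ u ∈ M', ¬ K u → lab u = t) (D : Finset (Sym2 T)) :
    potential lab K (D ∪ (M.map fun u => s(lab u, t)).toFinset) (A ++ M' ++ C) ≤
      potential lab K D (A ++ M ++ C) + 5 + 4 * M'.countP (K ·) := by
  obtain ⟨E₁, hE₁, s₁⟩ := labelContacts_append_subset (lab := lab) (K := K) (A ++ M') C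
  obtain ⟨E₂, hE₂, s₂⟩ := labelContacts_append_subset (lab := lab) (K := K) A M'
  have a₁ := labelChanges_append_le (lab := lab) (A ++ M') C
  have a₂ := labelChanges_append_le (lab := lab) A M'
  have b₁ := labelChanges_add_le (lab := lab) (A ++ M) C
  have b₂ := labelChanges_add_le (lab := lab) A M
  have c₁ : labelContacts lab K A ⊆ labelContacts lab K (A ++ M ++ C) := by
    rw [List.append_assoc]; exact labelContacts_subset_append_left _ _
  have c₂ : labelContacts lab K C ⊆ labelContacts lab K (A ++ M ++ C) :=
    labelContacts_subset_append_right _ _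
  have d₁ := card_toFinset_map_le_labelChanges (lab := lab) t M
  have d₂ := labelChanges_le_of_label_eq t M' h
  have d₃ := card_labelContacts_le (lab := lab) (K := K) M'
  unfold potential
  set N := (M.map fun u => s(lab u, t)).toFinset
  have key : D ∪ N ∪ labelContacts lab K (A ++ M' ++ C) ⊆
      (D ∪ labelContacts lab K (A ++ M ++ C)) ∪ (N ∪ (labelContacts lab K M' ∪ (E₁ ∪ E₂))) := by
    refine Finset.union_subset ?_ (s₁.trans (Finset.union_subset (Finset.union_subset
      (s₂.trans ?_) (c₂.trans ?_)) ?_))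
    · intro e; simp only [Finset.mem_union]; tauto
    · intro e he
      have := @c₁ e
      simp only [Finset.mem_union] at he ⊢; tauto
    · intro e; simp only [Finset.mem_union]; tauto
    · intro e; simp only [Finset.mem_union]; tauto
  have k₁ := Finset.card_le_card key
  have k₂ := Finset.card_union_le (D ∪ labelContacts lab K (A ++ M ++ C))
    (N ∪ (labelContacts lab K M' ∪ (E₁ ∪ E₂)))
  have k₃ := Finset.card_union_le N (labelContacts lab K M' ∪ (E₁ ∪ E₂))
  have k₄ := Finset.card_union_le (labelContacts lab K M') (E₁ ∪ E₂)
  have k₅ := Finset.card_union_le E₁ E₂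
  omega

end Words

/-! ### Lists and finite sets sorted by a real function -/

section Sorted

open Classical

variable {α : Type*}

theorem exists_list_sorted (s : Finset α) (g : α → ℝ)
    (hg : ∀ a ∈ s, ∀ b ∈ s, a ≠ b → g a ≠ g b) :
    ∃ w : List α, (∀ a, a ∈ w ↔ a ∈ s) ∧ w.Pairwise fun a b => g a < g b := by
  induction s using Finset.induction_on_max_value g with
  | empty => exact ⟨[], by simp, List.Pairwise.nil⟩
  | insert a s ha hmax ih =>
    obtain ⟨w, hw, hs⟩ := ih fun b hb c hc => hg b (by simp [hb]) c (by simp [hc])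
    refine ⟨w ++ [a], by simp [hw, or_comm], List.pairwise_append.2 ⟨hs, by simp, ?_⟩⟩
    intro b hb c hc
    rw [List.mem_singleton.1 hc]
    have hb := (hw b).1 hb
    exact lt_of_le_of_ne (hmax b hb) (hg b (by simp [hb]) a (by simp) (by rintro rfl; exact ha hb))

theorem eq_filter_append_filter_append_filter (w : List α) (g : α → ℝ) (c : ℝ)
    (h : w.Pairwise fun a b => g a ≤ g b) :
    w = w.filter (g · < c) ++ w.filter (g · = c) ++ w.filter (c < g ·) := by
  induction w with
  | nil => rfl
  | cons a w ih =>
    obtain ⟨ha, hw⟩ := List.pairwise_cons.1 h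
    have ih := ih hw
    rcases lt_trichotomy (g a) c with hac | hac | hac
    · simp only [List.filter_cons, hac, hac.ne, hac.not_gt, decide_true, decide_false, if_true,
        List.cons_append, Bool.false_eq_true, if_false]
      rw [← ih]
    · have h₁ : w.filter (g · < c) = [] := by
        simp only [List.filter_eq_nil_iff, decide_eq_true_eq, not_lt]
        exact fun b hb => hac ▸ ha b hb
      rw [h₁] at ih
      simp only [List.filter_cons, hac, lt_irrefl, decide_true, decide_false, if_true,
        List.cons_append, Bool.false_eq_true, if_false, h₁, List.nil_append] at ih ⊢
      rw [← ih]
    · have h₁ : w.filter (g · < c) = [] := by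
        simp only [List.filter_eq_nil_iff, decide_eq_true_eq, not_lt]
        exact fun b hb => hac.le.trans (ha b hb)
      have h₂ : w.filter (g · = c) = [] := by
        simp only [List.filter_eq_nil_iff, decide_eq_true_eq]
        exact fun b hb => (hac.trans_le (ha b hb)).ne'
      rw [h₁, h₂] at ih
      simp only [List.filter_cons, hac, hac.ne', hac.not_gt, decide_true, decide_false, if_true,
        Bool.false_eq_true, if_false, h₁, h₂, List.nil_append] at ih ⊢
      rw [← ih]

theorem card_filter_lt_add_card_filter_eq_le {β : Type*} (S : Finset β) (g : β → ℝ) {a t b : ℝ}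
    (hat : a < t) (htb : t < b) :
    (S.filter (g · < a)).card + (S.filter (g · = t)).card ≤ (S.filter (g · < b)).card := by
  rw [← Finset.card_union_of_disjoint]
  · refine Finset.card_le_card fun s hs => ?_
    simp only [Finset.mem_union, Finset.mem_filter] at hs ⊢
    rcases hs with ⟨h, h'⟩ | ⟨h, h'⟩
    · exact ⟨h, h'.trans (hat.trans htb)⟩
    · exact ⟨h, h'.trans_lt htb⟩
  · refine Finset.disjoint_left.2 fun s hs hs' => ?_
    rw [Finset.mem_filter] at hs hs'
    exact (hs.2.trans hat).ne hs'.2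

end Sorted

/-! ### Sweeping an arrangement of curves -/

/-- How a point of the union of the obstacles is seen by a connector that ends there: as a point
of the relative interior of a unique obstacle, or as a tip, which is recorded by its abscissa. Tips
are the endpoints of obstacles and the obstacles reduced to a point. -/
inductive PointKind (α : Type*)
  | interior (x : α)
  | tip (t : ℝ)

/-- A finite arrangement of graphs of continuous functions on compact intervals, in which the curves
may touch but do not cross. The *connectors* are curves that have both ends on the *obstacles* and
meet the other curves in their ends only. -/
structure Arrangement (α : Type*) [DecidableEq α] where
  /-- the obstacles -/
  obstacles : Finset α
  /-- the connectors -/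
  connectors : Finset α
  /-- abscissa of the left end of a curve -/
  left : α → ℝ
  /-- abscissa of the right end of a curve -/
  right : α → ℝ
  /-- the function whose graph over `[left o, right o]` is the curve `o` -/
  height : α → ℝ → ℝ
  /-- abscissas of the tips, among which are those of the ends of all obstacles -/
  tips : Finset ℝ
  /-- kind of the left end of a connector -/
  leftKind : α → PointKind α
  /-- kind of the right end of a connector -/
  rightKind : α → PointKind α
  disjoint_obstacles_connectors : Disjoint obstacles connectors
  left_lt_right : ∀ o ∈ obstacles ∪ connectors, left o < right o
  continuous_height : ∀ o, Continuous (height o)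
  height_ne : ∀ o ∈ obstacles ∪ connectors, ∀ o' ∈ obstacles ∪ connectors, o ≠ o' →
    ∀ t, left o < t → t < right o → left o' < t → t < right o' → height o t ≠ height o' t
  /-- ends with the same abscissa coincide -/
  height_eq_of_ends : ∀ o ∈ obstacles ∪ connectors, ∀ o' ∈ obstacles ∪ connectors, ∀ t,
    (t = left o ∨ t = right o) → (t = left o' ∨ t = right o') → height o t = height o' t
  connector_height_ne : ∀ v ∈ connectors, ∀ o ∈ obstacles ∪ connectors, o ≠ v →
    ∀ t, left v < t → t < right v → left o ≤ t → t ≤ right o → height v t ≠ height o t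
  mem_tips : ∀ x ∈ obstacles, left x ∈ tips ∧ right x ∈ tips
  leftKind_spec : ∀ v ∈ connectors,
    (left v ∈ tips ∧ leftKind v = .tip (left v)) ∨
      (left v ∉ tips ∧ ∃ x ∈ obstacles, leftKind v = .interior x ∧ left x < left v ∧
        left v < right x ∧ height x (left v) = height v (left v))
  rightKind_spec : ∀ v ∈ connectors,
    (right v ∈ tips ∧ rightKind v = .tip (right v)) ∨
      (right v ∉ tips ∧ ∃ x ∈ obstacles, rightKind v = .interior x ∧ left x < right v ∧
        right v < right x ∧ height x (right v) = height v (right v))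
  leftKind_ne_rightKind : ∀ v ∈ connectors, leftKind v ≠ rightKind v

namespace Arrangement

open Classical

variable {α : Type*} [DecidableEq α] (𝒜 : Arrangement α)

/-- All curves of the arrangement. -/
def curves : Finset α := 𝒜.obstacles ∪ 𝒜.connectors

/-- The label of a curve: an obstacle is labelled by its own interior, a connector by the kind of
its left end. -/
noncomputable def label (o : α) : PointKind α :=
  if o ∈ 𝒜.obstacles then .interior o else 𝒜.leftKind o

/-- The word read by the vertical line at `t`: the curves that cross the line, from bottom to
top. -/
structure IsWordAt (t : ℝ) (w : List α) : Prop where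
  mem_iff : ∀ o, o ∈ w ↔ o ∈ 𝒜.curves ∧ 𝒜.left o < t ∧ t < 𝒜.right o
  sorted : w.Pairwise fun o o' => 𝒜.height o t < 𝒜.height o' t

/-- The pairs of kinds of the connectors that lie to the left of the vertical line at `t`. -/
noncomputable def finishedPairs (t : ℝ) : Finset (Sym2 (PointKind α)) :=
  (𝒜.connectors.filter (𝒜.right · < t)).image fun v => s(𝒜.leftKind v, 𝒜.rightKind v)

/-- The diagonal pairs that belong to the obstacles. -/
noncomputable def diagonalPairs : Finset (Sym2 (PointKind α)) :=
  𝒜.obstacles.image fun x => s(.interior x, .interior x)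

/-- The abscissas of the ends of the curves. -/
noncomputable def events : Finset ℝ := 𝒜.curves.image 𝒜.left ∪ 𝒜.curves.image 𝒜.right

variable {𝒜}

theorem left_mem_events {o : α} (ho : o ∈ 𝒜.curves) : 𝒜.left o ∈ 𝒜.events :=
  Finset.mem_union_left _ (Finset.mem_image_of_mem _ ho)

theorem right_mem_events {o : α} (ho : o ∈ 𝒜.curves) : 𝒜.right o ∈ 𝒜.events :=
  Finset.mem_union_right _ (Finset.mem_image_of_mem _ ho)

theorem mem_curves_of_mem_obstacles {x : α} (hx : x ∈ 𝒜.obstacles) : x ∈ 𝒜.curves :=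
  Finset.mem_union_left _ hx

theorem mem_curves_of_mem_connectors {v : α} (hv : v ∈ 𝒜.connectors) : v ∈ 𝒜.curves :=
  Finset.mem_union_right _ hv

/-- Two curves keep their vertical order, by the intermediate value theorem. -/
theorem height_le_of_lt {o o' : α} (ho : o ∈ 𝒜.curves) (ho' : o' ∈ 𝒜.curves) {a b : ℝ}
    (hab : a ≤ b) (h₁ : 𝒜.left o ≤ a) (h₂ : 𝒜.left o' ≤ a) (h₃ : b ≤ 𝒜.right o)
    (h₄ : b ≤ 𝒜.right o') (h : 𝒜.height o a < 𝒜.height o' a) :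
    𝒜.height o b ≤ 𝒜.height o' b := by
  by_contra! hb
  have hcont : ContinuousOn (fun t => 𝒜.height o' t - 𝒜.height o t) (Set.Icc a b) :=
    ((𝒜.continuous_height o').sub (𝒜.continuous_height o)).continuousOn
  obtain ⟨c, ⟨hac, hcb⟩, hc⟩ := intermediate_value_Ioo' hab hcont
    (show (0 : ℝ) ∈ Set.Ioo _ _ from ⟨sub_neg.2 hb, sub_pos.2 h⟩)
  refine 𝒜.height_ne o ho o' ho' ?_ c (by linarith) (by linarith) (by linarith) (by linarith)
    (sub_eq_zero.1 hc).symm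
  rintro rfl
  exact lt_irrefl _ h

theorem height_lt_of_lt {o o' : α} (ho : o ∈ 𝒜.curves) (ho' : o' ∈ 𝒜.curves) {a b : ℝ}
    (hab : a < b) (h₁ : 𝒜.left o ≤ a) (h₂ : 𝒜.left o' ≤ a) (h₃ : b < 𝒜.right o)
    (h₄ : b < 𝒜.right o') (h : 𝒜.height o a < 𝒜.height o' a) :
    𝒜.height o b < 𝒜.height o' b := by
  refine lt_of_le_of_ne (height_le_of_lt ho ho' hab.le h₁ h₂ h₃.le h₄.le h)
    (𝒜.height_ne o ho o' ho' ?_ b (by linarith) h₃ (by linarith) h₄)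
  rintro rfl
  exact lt_irrefl _ h

/-- Passing a single event `t`, at the point of height `e`, replaces a factor of the word: the
curves through that point to the left of it give way to those to the right of it. -/
theorem IsWordAt.exists_step {a t b e : ℝ} {w : List α} (hw : 𝒜.IsWordAt a w) (hat : a < t)
    (htb : t < b) (hev : ∀ s ∈ 𝒜.events, a ≤ s → s ≤ b → s = t)
    (he : ∀ o ∈ 𝒜.curves, (t = 𝒜.left o ∨ t = 𝒜.right o) → 𝒜.height o t = e) :
    ∃ A M M' C : List α, w = A ++ M ++ C ∧ 𝒜.IsWordAt b (A ++ M' ++ C) ∧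
      (∀ o, o ∈ M ↔ o ∈ 𝒜.curves ∧ 𝒜.left o < t ∧ t ≤ 𝒜.right o ∧ 𝒜.height o t = e) ∧
      (∀ o, o ∈ M' ↔ o ∈ 𝒜.curves ∧ 𝒜.left o ≤ t ∧ t < 𝒜.right o ∧ 𝒜.height o t = e) := by
  have left_a : ∀ o ∈ 𝒜.curves, 𝒜.left o < t → 𝒜.left o < a := fun o ho h => by
    by_contra! h'
    exact h.ne (hev _ (left_mem_events ho) h' (h.le.trans htb.le))
  have right_a : ∀ o ∈ 𝒜.curves, a < 𝒜.right o → t ≤ 𝒜.right o := fun o ho h => by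
    by_contra! h'
    exact h'.ne (hev _ (right_mem_events ho) h.le (h'.le.trans htb.le))
  have left_b : ∀ o ∈ 𝒜.curves, 𝒜.left o < b → 𝒜.left o ≤ t := fun o ho h => by
    by_contra! h'
    exact h'.ne' (hev _ (left_mem_events ho) (hat.le.trans h'.le) h.le)
  have right_b : ∀ o ∈ 𝒜.curves, t < 𝒜.right o → b < 𝒜.right o := fun o ho h => by
    by_contra! h'
    exact h.ne' (hev _ (right_mem_events ho) (hat.le.trans h.le) h')
  have sorted_t : w.Pairwise fun o o' => 𝒜.height o t ≤ 𝒜.height o' t := by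
    refine hw.sorted.imp_of_mem fun {o o'} ho ho' h => ?_
    obtain ⟨ho, h₁, h₂⟩ := (hw.mem_iff _).1 ho
    obtain ⟨ho', h₃, h₄⟩ := (hw.mem_iff _).1 ho'
    exact height_le_of_lt ho ho' hat.le h₁.le h₃.le (right_a _ ho h₂) (right_a _ ho' h₄) h
  have keep : ∀ o ∈ w, 𝒜.height o t ≠ e → b < 𝒜.right o := by
    intro o ho hne
    obtain ⟨ho, h₁, h₂⟩ := (hw.mem_iff _).1 ho
    exact right_b o ho (lt_of_le_of_ne (right_a o ho h₂) fun h => hne (he o ho (.inr h)))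
  have sorted_b : ∀ p : α → Bool, (∀ o, p o = true → 𝒜.height o t ≠ e) →
      (w.filter p).Pairwise fun o o' => 𝒜.height o b < 𝒜.height o' b := by
    intro p hp
    refine (hw.sorted.filter p).imp_of_mem fun {o o'} ho ho' h => ?_
    rw [List.mem_filter] at ho ho'
    obtain ⟨hc, h₁, -⟩ := (hw.mem_iff _).1 ho.1
    obtain ⟨hc', h₃, -⟩ := (hw.mem_iff _).1 ho'.1
    exact height_lt_of_lt hc hc' (hat.trans htb) h₁.le h₃.le (keep _ ho.1 (hp _ ho.2))
      (keep _ ho'.1 (hp _ ho'.2)) h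
  obtain ⟨M', hM', sorted_M'⟩ := exists_list_sorted
    (𝒜.curves.filter fun o => 𝒜.left o ≤ t ∧ t < 𝒜.right o ∧ 𝒜.height o t = e)
    (fun o => 𝒜.height o b) (by
      intro o ho o' ho' hne
      rw [Finset.mem_filter] at ho ho'
      exact 𝒜.height_ne o ho.1 o' ho'.1 hne b (ho.2.1.trans_lt htb) (right_b _ ho.1 ho.2.2.1)
        (ho'.2.1.trans_lt htb) (right_b _ ho'.1 ho'.2.2.1))
  simp only [Finset.mem_filter] at hM'
  have order : ∀ o ∈ 𝒜.curves, ∀ o' ∈ 𝒜.curves, 𝒜.left o ≤ t → 𝒜.left o' ≤ t →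
      b < 𝒜.right o → b < 𝒜.right o' → 𝒜.height o t < 𝒜.height o' t →
      𝒜.height o b < 𝒜.height o' b := fun o ho o' ho' h₁ h₂ h₃ h₄ h =>
    height_lt_of_lt ho ho' htb h₁ h₂ h₃ h₄ h
  refine ⟨w.filter (𝒜.height · t < e), w.filter (𝒜.height · t = e), M',
    w.filter (e < 𝒜.height · t), eq_filter_append_filter_append_filter w _ e sorted_t,
    ⟨?_, ?_⟩, ?_, hM'⟩
  · intro o
    simp only [List.mem_append, List.mem_filter, decide_eq_true_eq, hM']
    constructor
    · rintro ((⟨ho, h⟩ | ⟨ho, h₁, h₂, -⟩) | ⟨ho, h⟩)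
      · have := (hw.mem_iff _).1 ho
        exact ⟨this.1, this.2.1.trans (hat.trans htb), keep o ho h.ne⟩
      · exact ⟨ho, h₁.trans_lt htb, right_b o ho h₂⟩
      · have := (hw.mem_iff _).1 ho
        exact ⟨this.1, this.2.1.trans (hat.trans htb), keep o ho h.ne'⟩
    · rintro ⟨ho, h₁, h₂⟩
      have hl := left_b o ho h₁
      have hr : t < 𝒜.right o := htb.trans h₂
      have mem : 𝒜.height o t ≠ e → o ∈ w := fun hne =>
        (hw.mem_iff _).2 ⟨ho, left_a o ho (lt_of_le_of_ne hl fun h => hne (he o ho (.inl h.symm))),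
          hat.trans hr⟩
      rcases lt_trichotomy (𝒜.height o t) e with h | h | h
      · exact .inl (.inl ⟨mem h.ne, h⟩)
      · exact .inl (.inr ⟨ho, hl, hr, h⟩)
      · exact .inr ⟨mem h.ne', h⟩
  · have info : ∀ o ∈ w, 𝒜.height o t ≠ e → o ∈ 𝒜.curves ∧ 𝒜.left o ≤ t ∧ b < 𝒜.right o :=
      fun o ho hne => ⟨((hw.mem_iff _).1 ho).1, ((hw.mem_iff _).1 ho).2.1.le.trans hat.le,
        keep o ho hne⟩
    refine List.pairwise_append.2 ⟨List.pairwise_append.2 ⟨sorted_b _ ?_, sorted_M', ?_⟩,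
      sorted_b _ ?_, ?_⟩
    · intro o ho; exact (of_decide_eq_true ho).ne
    · intro o ho o' ho'
      obtain ⟨ho, h⟩ := List.mem_filter.1 ho
      have h := of_decide_eq_true h
      obtain ⟨i₁, i₂, i₃⟩ := info o ho h.ne
      obtain ⟨j₁, j₂, j₃, j₄⟩ := (hM' o').1 ho'
      exact order o i₁ o' j₁ i₂ j₂ i₃ (right_b _ j₁ j₃) (j₄ ▸ h)
    · intro o ho; exact (of_decide_eq_true ho).ne'
    · intro o ho o' ho'
      obtain ⟨ho', h'⟩ := List.mem_filter.1 ho'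
      have h' := of_decide_eq_true h'
      obtain ⟨i₁, i₂, i₃⟩ := info o' ho' h'.ne'
      rcases List.mem_append.1 ho with ho | ho
      · obtain ⟨ho, h⟩ := List.mem_filter.1 ho
        have h := of_decide_eq_true h
        obtain ⟨j₁, j₂, j₃⟩ := info o ho h.ne
        exact order o j₁ o' i₁ j₂ i₂ j₃ i₃ (h.trans h')
      · obtain ⟨j₁, j₂, j₃, j₄⟩ := (hM' o).1 ho
        exact order o j₁ o' i₁ j₂ i₂ (right_b _ j₁ j₃) i₃ (j₄ ▸ h')
  · intro o
    simp only [List.mem_filter, decide_eq_true_eq, hw.mem_iff]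
    constructor
    · rintro ⟨⟨ho, h₁, h₂⟩, h⟩
      exact ⟨ho, h₁.trans hat, right_a o ho h₂, h⟩
    · rintro ⟨ho, h₁, h₂, h⟩
      exact ⟨⟨ho, left_a o ho h₁, hat.trans_le h₂⟩, h⟩

theorem label_of_mem_obstacles {x : α} (hx : x ∈ 𝒜.obstacles) : 𝒜.label x = .interior x :=
  if_pos hx

theorem label_of_mem_connectors {v : α} (hv : v ∈ 𝒜.connectors) : 𝒜.label v = 𝒜.leftKind v :=
  if_neg fun h => Finset.disjoint_left.1 𝒜.disjoint_obstacles_connectors h hv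

theorem mem_connectors_of_notMem_obstacles {o : α} (ho : o ∈ 𝒜.curves) (h : o ∉ 𝒜.obstacles) :
    o ∈ 𝒜.connectors :=
  (Finset.mem_union.1 ho).resolve_left h

theorem IsWordAt.nodup {t : ℝ} {w : List α} (hw : 𝒜.IsWordAt t w) : w.Nodup :=
  hw.sorted.imp fun {a b} h => by rintro rfl; exact lt_irrefl _ h

/-- No connector passes through an end of a curve. -/
theorem connector_height_ne_of_end {v o : α} {t : ℝ} (hv : v ∈ 𝒜.connectors) (ho : o ∈ 𝒜.curves)
    (hend : t = 𝒜.left o ∨ t = 𝒜.right o) (h₁ : 𝒜.left v < t) (h₂ : t < 𝒜.right v) :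
    𝒜.height v t ≠ 𝒜.height o t := by
  have hlt := 𝒜.left_lt_right o ho
  refine 𝒜.connector_height_ne v hv o ho ?_ t h₁ h₂ ?_ ?_
  · rintro rfl
    rcases hend with rfl | rfl
    · exact lt_irrefl _ h₁
    · exact lt_irrefl _ h₂
  all_goals rcases hend with rfl | rfl
  exacts [le_rfl, hlt.le, hlt.le, le_rfl]

/-- At most one obstacle passes through a given point. -/
theorem countP_obstacles_le {t e : ℝ} {M : List α} (hM : M.Nodup)
    (h : ∀ o, o ∈ M ↔ o ∈ 𝒜.curves ∧ 𝒜.left o ≤ t ∧ t < 𝒜.right o ∧ 𝒜.height o t = e) :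
    M.countP (· ∈ 𝒜.obstacles) ≤ (𝒜.obstacles.filter (𝒜.left · = t)).card + 1 := by
  rw [List.countP_eq_length_filter, ← List.toFinset_card_of_nodup (hM.filter _)]
  set S := 𝒜.obstacles.filter fun x => 𝒜.left x < t ∧ t < 𝒜.right x ∧ 𝒜.height x t = e with hS
  have hS₁ : S.card ≤ 1 := by
    refine Finset.card_le_one.2 fun x hx y hy => ?_
    simp only [hS, Finset.mem_filter] at hx hy
    by_contra hxy
    exact 𝒜.height_ne x (mem_curves_of_mem_obstacles hx.1) y (mem_curves_of_mem_obstacles hy.1) hxy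
      t hx.2.1 hx.2.2.1 hy.2.1 hy.2.2.1 (hx.2.2.2.trans hy.2.2.2.symm)
  refine (Finset.card_le_card (t := 𝒜.obstacles.filter (𝒜.left · = t) ∪ S) fun x hx => ?_).trans
    ((Finset.card_union_le _ _).trans (by omega))
  simp only [List.mem_toFinset, List.mem_filter, decide_eq_true_eq, h] at hx
  simp only [hS, Finset.mem_union, Finset.mem_filter]
  rcases hx.1.2.1.eq_or_lt with h' | h'
  · exact .inl ⟨hx.2, h'⟩
  · exact .inr ⟨hx.2, h', hx.1.2.2⟩

/-- The pairs finished between `a` and `b` come from connectors that end at the only event `t`. -/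
theorem finishedPairs_subset {a t b : ℝ}
    (hev : ∀ s ∈ 𝒜.events, a ≤ s → s ≤ b → s = t) (N : Finset (Sym2 (PointKind α)))
    (hN : ∀ v ∈ 𝒜.connectors, 𝒜.right v = t → s(𝒜.leftKind v, 𝒜.rightKind v) ∈ N) :
    𝒜.finishedPairs b ∪ 𝒜.diagonalPairs ⊆ 𝒜.finishedPairs a ∪ 𝒜.diagonalPairs ∪ N := by
  refine Finset.union_subset ?_
    (Finset.subset_union_right.trans Finset.subset_union_left)
  intro p hp
  obtain ⟨v, hv, rfl⟩ := Finset.mem_image.1 hp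
  obtain ⟨hv, hvb⟩ := Finset.mem_filter.1 hv
  by_cases h : a ≤ 𝒜.right v
  · exact Finset.mem_union_right _ (hN v hv
      (hev _ (right_mem_events (mem_curves_of_mem_connectors hv)) h hvb.le))
  · refine Finset.mem_union_left _ (Finset.mem_union_left _ ?_)
    exact Finset.mem_image_of_mem _ (Finset.mem_filter.2 ⟨hv, not_le.1 h⟩)

/-- The change of the potential at an event: there is none unless the event is at a tip, and
at a tip it is bounded in terms of the number of obstacles that start there. -/
theorem IsWordAt.exists_potential_le {a t b : ℝ} {w : List α} (hw : 𝒜.IsWordAt a w) (hat : a < t)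
    (htb : t < b) (ht : t ∈ 𝒜.events) (hev : ∀ s ∈ 𝒜.events, a ≤ s → s ≤ b → s = t) :
    ∃ w', 𝒜.IsWordAt b w' ∧
      potential 𝒜.label (· ∈ 𝒜.obstacles) (𝒜.finishedPairs b ∪ 𝒜.diagonalPairs) w' ≤
        potential 𝒜.label (· ∈ 𝒜.obstacles) (𝒜.finishedPairs a ∪ 𝒜.diagonalPairs) w +
          9 * (𝒜.tips.filter (· = t)).card + 4 * (𝒜.obstacles.filter (𝒜.left · = t)).card := by
  obtain ⟨o, ho, hend⟩ : ∃ o ∈ 𝒜.curves, t = 𝒜.left o ∨ t = 𝒜.right o := by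
    rcases Finset.mem_union.1 ht with h | h <;> obtain ⟨o, ho, rfl⟩ := Finset.mem_image.1 h
    exacts [⟨o, ho, .inl rfl⟩, ⟨o, ho, .inr rfl⟩]
  obtain ⟨A, M, M', C, rfl, hw', hM, hM'⟩ := hw.exists_step hat htb hev
    fun o' ho' h => 𝒜.height_eq_of_ends o' ho' o ho t h hend
  have connector_M : ∀ v ∈ 𝒜.connectors, v ∈ M → 𝒜.right v = t := fun v hv h => by
    obtain ⟨-, h₁, h₂, h₃⟩ := (hM v).1 h
    by_contra h'
    exact connector_height_ne_of_end hv ho hend h₁ (lt_of_le_of_ne h₂ (Ne.symm h')) h₃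
  have connector_M' : ∀ v ∈ 𝒜.connectors, v ∈ M' → 𝒜.left v = t := fun v hv h => by
    obtain ⟨-, h₁, h₂, h₃⟩ := (hM' v).1 h
    by_contra h'
    exact connector_height_ne_of_end hv ho hend (lt_of_le_of_ne h₁ h') h₂ h₃
  have mem_M : ∀ v ∈ 𝒜.connectors, 𝒜.right v = t → v ∈ M := fun v hv h =>
    have hc := mem_curves_of_mem_connectors hv
    (hM v).2 ⟨hc, h ▸ 𝒜.left_lt_right v hc, h.ge,
      𝒜.height_eq_of_ends v hc o ho t (.inr h.symm) hend⟩
  have nodup_M : M.Nodup := hw.nodup.of_append_left.of_append_right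
  have nodup_M' : M'.Nodup := hw'.nodup.of_append_left.of_append_right
  refine ⟨A ++ M' ++ C, hw', ?_⟩
  -- At a tip an arbitrary factor may be replaced; elsewhere an obstacle passes through the point,
  -- and only connectors arrive or depart.
  by_cases htip : t ∈ 𝒜.tips
  · have hcount := countP_obstacles_le nodup_M' hM'
    have htips : (𝒜.tips.filter (· = t)).card = 1 := by
      rw [Finset.filter_eq', if_pos htip, Finset.card_singleton]
    have hlab : ∀ u ∈ M', ¬ u ∈ 𝒜.obstacles → 𝒜.label u = .tip t := by
      intro u hu hK
      have hv := mem_connectors_of_notMem_obstacles ((hM' u).1 hu).1 hK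
      have hut := connector_M' u hv hu
      rcases 𝒜.leftKind_spec u hv with h | h
      · rw [label_of_mem_connectors hv, h.2, hut]
      · exact absurd (hut ▸ htip) h.1
    have hfin := finishedPairs_subset hev (M.map fun u => s(𝒜.label u, .tip t)).toFinset
      fun v hv hvt => by
        rw [List.mem_toFinset, List.mem_map]
        refine ⟨v, mem_M v hv hvt, ?_⟩
        rcases 𝒜.rightKind_spec v hv with h | h
        · rw [label_of_mem_connectors hv, h.2, hvt]
        · exact absurd (hvt ▸ htip) h.1
    have h₁ := potential_mono (lab := 𝒜.label) (K := (· ∈ 𝒜.obstacles)) hfin (A ++ M' ++ C)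
    have h₂ := potential_replace_le (lab := 𝒜.label) (K := (· ∈ 𝒜.obstacles)) (.tip t) A C M M' hlab
      (𝒜.finishedPairs a ∪ 𝒜.diagonalPairs)
    refine h₁.trans (h₂.trans ?_)
    rw [htips]
    omega
  · have hoc : o ∈ 𝒜.connectors := mem_connectors_of_notMem_obstacles ho fun h => by
      rcases hend with rfl | rfl
      exacts [htip (𝒜.mem_tips o h).1, htip (𝒜.mem_tips o h).2]
    obtain ⟨x, hx, hx₁, hx₂, hx₃⟩ : ∃ x ∈ 𝒜.obstacles, 𝒜.left x < t ∧ t < 𝒜.right x ∧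
        𝒜.height x t = 𝒜.height o t := by
      rcases hend with rfl | rfl
      · obtain ⟨x, hx, -, h⟩ := ((𝒜.leftKind_spec o hoc).resolve_left fun h => htip h.1).2
        exact ⟨x, hx, h⟩
      · obtain ⟨x, hx, -, h⟩ := ((𝒜.rightKind_spec o hoc).resolve_left fun h => htip h.1).2
        exact ⟨x, hx, h⟩
    have hxc := mem_curves_of_mem_obstacles hx
    -- The obstacle `x` is the only one at this point.
    have unique : ∀ y ∈ 𝒜.obstacles, 𝒜.left y ≤ t → t ≤ 𝒜.right y →
        𝒜.height y t = 𝒜.height o t → y = x := fun y hy h₁ h₂ h₃ => by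
      by_contra hyx
      exact 𝒜.height_ne y (mem_curves_of_mem_obstacles hy) x hxc hyx t
        (lt_of_le_of_ne h₁ fun h => htip (h ▸ (𝒜.mem_tips y hy).1))
        (lt_of_le_of_ne h₂ fun h => htip (h ▸ (𝒜.mem_tips y hy).2)) hx₁ hx₂ (h₃.trans hx₃.symm)
    have right_eq : ∀ v ∈ 𝒜.connectors, 𝒜.right v = t → 𝒜.rightKind v = .interior x := by
      intro v hv hvt
      obtain ⟨y, hy, hk, h₁, h₂, h₃⟩ :=
        ((𝒜.rightKind_spec v hv).resolve_left fun h => htip (hvt ▸ h.1)).2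
      rw [hvt] at h₁ h₂ h₃
      rw [hk, unique y hy h₁.le h₂.le (h₃.trans (𝒜.height_eq_of_ends v
        (mem_curves_of_mem_connectors hv) o ho t (.inr hvt.symm) hend))]
    have left_eq : ∀ v ∈ 𝒜.connectors, 𝒜.left v = t → 𝒜.leftKind v = .interior x := by
      intro v hv hvt
      obtain ⟨y, hy, hk, h₁, h₂, h₃⟩ :=
        ((𝒜.leftKind_spec v hv).resolve_left fun h => htip (hvt ▸ h.1)).2
      rw [hvt] at h₁ h₂ h₃
      rw [hk, unique y hy h₁.le h₂.le (h₃.trans (𝒜.height_eq_of_ends v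
        (mem_curves_of_mem_connectors hv) o ho t (.inl hvt.symm) hend))]
    have label_M : ∀ u ∈ M, u ≠ x → 𝒜.label u ≠ 𝒜.label x := fun u hu hux => by
      obtain ⟨hc, h₁, h₂, h₃⟩ := (hM u).1 hu
      have hv := mem_connectors_of_notMem_obstacles hc fun h => hux (unique u h h₁.le h₂ h₃)
      rw [label_of_mem_connectors hv, label_of_mem_obstacles hx,
        ← right_eq u hv (connector_M u hv hu)]
      exact 𝒜.leftKind_ne_rightKind u hv
    have label_M' : ∀ u ∈ M', u ≠ x → 𝒜.label u = 𝒜.label x := fun u hu hux => by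
      obtain ⟨hc, h₁, h₂, h₃⟩ := (hM' u).1 hu
      have hv := mem_connectors_of_notMem_obstacles hc fun h => hux (unique u h h₁ h₂.le h₃)
      rw [label_of_mem_connectors hv, label_of_mem_obstacles hx,
        left_eq u hv (connector_M' u hv hu)]
    obtain ⟨a₁, a₂, rfl⟩ := List.append_of_mem ((hM x).2 ⟨hxc, hx₁, hx₂.le, hx₃⟩)
    obtain ⟨d₁, d₂, rfl⟩ := List.append_of_mem ((hM' x).2 ⟨hxc, hx₁.le, hx₂, hx₃⟩)
    have ha := (List.nodup_middle.1 nodup_M).notMem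
    have hd := (List.nodup_middle.1 nodup_M').notMem
    rw [List.mem_append, not_or] at ha hd
    have hfin := finishedPairs_subset hev
      ((a₁ ++ a₂).map fun u => s(𝒜.label u, 𝒜.label x)).toFinset fun v hv hvt => by
        have hvx : v ≠ x := fun h =>
          Finset.disjoint_left.1 𝒜.disjoint_obstacles_connectors hx (h ▸ hv)
        rw [List.mem_toFinset, List.mem_map]
        refine ⟨v, ?_, by rw [label_of_mem_connectors hv, label_of_mem_obstacles hx,
          right_eq v hv hvt]⟩
        have := mem_M v hv hvt
        simp only [List.mem_append, List.mem_cons, hvx, false_or] at this ⊢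
        exact this
    have h₁ := potential_mono (lab := 𝒜.label) (K := (· ∈ 𝒜.obstacles)) hfin
      (A ++ (d₁ ++ x :: d₂) ++ C)
    have h₂ := potential_exchange_le (lab := 𝒜.label) (K := (· ∈ 𝒜.obstacles)) A C a₁ a₂ d₁ d₂ hx
      (fun u hu => label_M u (by simp [hu]) fun h => ha.1 (h ▸ hu))
      (fun u hu => label_M u (by simp [hu]) fun h => ha.2 (h ▸ hu))
      (fun u hu => label_M' u (by simp [hu]) fun h => hd.1 (h ▸ hu))
      (fun u hu => label_M' u (by simp [hu]) fun h => hd.2 (h ▸ hu))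
      (𝒜.finishedPairs a ∪ 𝒜.diagonalPairs) (by
        rw [label_of_mem_obstacles hx]
        exact Finset.mem_union_right _ (Finset.mem_image_of_mem _ hx))
    exact (h₁.trans h₂).trans (by omega)

/-- The sweep: the potential at a line is bounded by summing its increments over the tips to the
left of the line. -/
theorem exists_word_potential_le (b : ℝ) (hb : b ∉ 𝒜.events) :
    ∃ w, 𝒜.IsWordAt b w ∧
      potential 𝒜.label (· ∈ 𝒜.obstacles) (𝒜.finishedPairs b ∪ 𝒜.diagonalPairs) w ≤
        𝒜.obstacles.card + 9 * (𝒜.tips.filter (· < b)).card +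
          4 * (𝒜.obstacles.filter (𝒜.left · < b)).card := by
  induction hn : (𝒜.events.filter (· < b)).card using Nat.strong_induction_on generalizing b with
  | _ n ih =>
  by_cases hne : (𝒜.events.filter (· < b)).Nonempty
  · obtain ⟨t, ht, hmax⟩ := Finset.exists_max_image _ id hne
    obtain ⟨ht, htb⟩ := Finset.mem_filter.1 ht
    have hmax : ∀ s ∈ 𝒜.events, s < b → s ≤ t := fun s hs h =>
      hmax s (Finset.mem_filter.2 ⟨hs, h⟩)
    -- A line `a` between `t` and the event before it.
    obtain ⟨a, ha, hat⟩ : ∃ a, (∀ s ∈ 𝒜.events.filter (· < t), s < a) ∧ a < t :=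
      (((Finset.eventually_all (𝒜.events.filter (· < t))).2 fun s hs =>
        mem_nhdsWithin_of_mem_nhds (Ioi_mem_nhds (Finset.mem_filter.1 hs).2)).and
        (self_mem_nhdsWithin (s := Set.Iio t))).exists
    have ha : ∀ s ∈ 𝒜.events, s < t → s < a := fun s hs h =>
      ha s (Finset.mem_filter.2 ⟨hs, h⟩)
    have hcard : (𝒜.events.filter (· < a)).card < n := by
      rw [← hn]
      refine Finset.card_lt_card ((Finset.ssubset_iff_of_subset fun s hs => ?_).2
        ⟨t, Finset.mem_filter.2 ⟨ht, htb⟩, fun h => hat.not_gt (Finset.mem_filter.1 h).2⟩)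
      obtain ⟨hs, h⟩ := Finset.mem_filter.1 hs
      exact Finset.mem_filter.2 ⟨hs, h.trans (hat.trans htb)⟩
    obtain ⟨w, hw, hpot⟩ := ih _ hcard a (fun h => lt_irrefl _ (ha a h hat)) rfl
    obtain ⟨w', hw', hpot'⟩ := hw.exists_potential_le hat htb ht fun s hs h₁ h₂ => by
      have hsb : s < b := lt_of_le_of_ne h₂ fun h => hb (h ▸ hs)
      refine (hmax s hs hsb).eq_or_lt.resolve_right fun h => h₁.not_gt (ha s hs h)
    refine ⟨w', hw', hpot'.trans ?_⟩
    have c₁ := card_filter_lt_add_card_filter_eq_le 𝒜.tips id hat htb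
    have c₂ := card_filter_lt_add_card_filter_eq_le 𝒜.obstacles 𝒜.left hat htb
    simp only [id] at c₁
    omega
  · rw [Finset.not_nonempty_iff_eq_empty, Finset.filter_eq_empty_iff] at hne
    refine ⟨[], ⟨fun o => ?_, List.Pairwise.nil⟩, ?_⟩
    · simp only [List.not_mem_nil, false_iff, not_and]
      exact fun ho h => absurd h (hne (left_mem_events ho))
    · have h₁ : 𝒜.finishedPairs b = ∅ := by
        rw [finishedPairs, Finset.image_eq_empty, Finset.filter_eq_empty_iff]
        exact fun v hv => hne (right_mem_events (mem_curves_of_mem_connectors hv))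
      have h₂ : 𝒜.diagonalPairs.card ≤ 𝒜.obstacles.card := Finset.card_image_le
      simp only [potential, labelContacts, labelChanges, h₁, Finset.empty_union,
        Finset.union_empty]
      omega

/-- The connectors realize only linearly many unordered pairs of kinds of their ends. -/
theorem card_image_kinds_le :
    (𝒜.connectors.image fun v => s(𝒜.leftKind v, 𝒜.rightKind v)).card ≤
      5 * 𝒜.obstacles.card + 9 * 𝒜.tips.card := by
  obtain ⟨b, hb⟩ := 𝒜.events.bddAbove
  have hlt : ∀ s ∈ 𝒜.events, s < b + 1 := fun s hs => (hb hs).trans_lt (lt_add_one b)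
  obtain ⟨w, -, hw⟩ := exists_word_potential_le (𝒜 := 𝒜) (b + 1) fun h => lt_irrefl _ (hlt _ h)
  have h₁ : 𝒜.finishedPairs (b + 1) =
      𝒜.connectors.image fun v => s(𝒜.leftKind v, 𝒜.rightKind v) := by
    rw [finishedPairs, Finset.filter_true_of_mem]
    exact fun v hv => hlt _ (right_mem_events (mem_curves_of_mem_connectors hv))
  have h₂ := Finset.card_filter_le 𝒜.tips (· < b + 1)
  have h₃ := Finset.card_filter_le 𝒜.obstacles (𝒜.left · < b + 1)
  have h₄ : (𝒜.finishedPairs (b + 1)).card ≤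
      (𝒜.finishedPairs (b + 1) ∪ 𝒜.diagonalPairs ∪
        labelContacts 𝒜.label (· ∈ 𝒜.obstacles) w).card :=
    Finset.card_le_card (Finset.subset_union_left.trans Finset.subset_union_left)
  rw [potential] at hw
  rw [← h₁]
  omega

end Arrangement

/-! ### Coordinates adapted to a contact representation -/

/-- The first coordinate of a point after a shear of the plane with parameter `c`. -/
noncomputable def abscissa (c : ℝ) (z : Plane) : ℝ := z 0 + c * z 1

theorem eq_of_abscissa_eq {c : ℝ} {z w : Plane} (h : abscissa c z = abscissa c w)
    (h₁ : z 1 = w 1) : z = w := by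
  ext i
  fin_cases i
  · simp only [abscissa, h₁, add_left_inj] at h
    exact h
  · exact h₁

theorem exists_injOn_abscissa {S : Set Plane} (hS : S.Finite) : ∃ c, Set.InjOn (abscissa c) S := by
  -- A parameter is bad if it equals the quotient below for two points of `S`.
  obtain ⟨c, -, hc⟩ := Set.infinite_univ.exists_notMem_finite
    (hS.image2 (fun z w : Plane => (w 0 - z 0) / (z 1 - w 1)) hS)
  refine ⟨c, fun z hz w hw h => ?_⟩
  by_contra hne
  have h₁ : z 1 - w 1 ≠ 0 := fun h₁ => hne (eq_of_abscissa_eq h (sub_eq_zero.1 h₁))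
  refine hc ⟨z, hz, w, hw, ?_⟩
  simp only [abscissa] at h
  rw [div_eq_iff h₁]
  linarith

/-- The second coordinate of the point of abscissa `t` on the line through `p` and `q`. -/
noncomputable def lineHeight (c : ℝ) (p q : Plane) (t : ℝ) : ℝ :=
  p 1 + (t - abscissa c p) / (abscissa c q - abscissa c p) * (q 1 - p 1)

theorem lineHeight_left (c : ℝ) (p q : Plane) : lineHeight c p q (abscissa c p) = p 1 := by
  simp [lineHeight]

theorem lineHeight_right {c : ℝ} {p q : Plane} (h : abscissa c p < abscissa c q) :
    lineHeight c p q (abscissa c q) = q 1 := by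
  rw [lineHeight, div_self (sub_pos.2 h).ne']
  ring

theorem continuous_lineHeight (c : ℝ) (p q : Plane) : Continuous (lineHeight c p q) := by
  unfold lineHeight
  fun_prop

theorem abscissa_mem_Icc_of_mem_segment {c : ℝ} {p q z : Plane} (h : abscissa c p ≤ abscissa c q)
    (hz : z ∈ segment ℝ p q) : abscissa c p ≤ abscissa c z ∧ abscissa c z ≤ abscissa c q := by
  rw [segment_eq_image] at hz
  obtain ⟨θ, ⟨h₀, h₁⟩, rfl⟩ := hz
  simp only [abscissa, PiLp.add_apply, PiLp.smul_apply, smul_eq_mul] at h ⊢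
  constructor <;> nlinarith

theorem lineHeight_of_mem_segment {c : ℝ} {p q z : Plane} (h : abscissa c p < abscissa c q)
    (hz : z ∈ segment ℝ p q) : lineHeight c p q (abscissa c z) = z 1 := by
  rw [segment_eq_image] at hz
  obtain ⟨θ, -, rfl⟩ := hz
  have h' := (sub_pos.2 h).ne'
  have : abscissa c ((1 - θ) • p + θ • q) - abscissa c p = θ * (abscissa c q - abscissa c p) := by
    simp only [abscissa, PiLp.add_apply, PiLp.smul_apply, smul_eq_mul]; ring
  rw [lineHeight, this, mul_div_assoc, div_self h']
  simp only [PiLp.add_apply, PiLp.smul_apply, smul_eq_mul]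
  ring

/-- With `lineHeight_of_mem_segment`: a segment is the graph of `lineHeight` over an interval of
abscissas. -/
theorem mem_segment_of_lineHeight {c : ℝ} {p q z : Plane} (h : abscissa c p < abscissa c q)
    (h₁ : abscissa c p ≤ abscissa c z) (h₂ : abscissa c z ≤ abscissa c q)
    (hz : lineHeight c p q (abscissa c z) = z 1) : z ∈ segment ℝ p q := by
  have h' := sub_pos.2 h
  rw [segment_eq_image]
  refine ⟨(abscissa c z - abscissa c p) / (abscissa c q - abscissa c p),
    ⟨div_nonneg (sub_nonneg.2 h₁) h'.le, (div_le_one h').2 (by linarith)⟩, ?_⟩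
  have e₁ : (1 - (abscissa c z - abscissa c p) / (abscissa c q - abscissa c p)) * p 1 +
      (abscissa c z - abscissa c p) / (abscissa c q - abscissa c p) * q 1 = z 1 := by
    rw [← hz, lineHeight]; ring
  refine eq_of_abscissa_eq (c := c) ?_ (by simpa using e₁)
  have e₂ := div_mul_cancel₀ (abscissa c z - abscissa c p) h'.ne'
  set θ := (abscissa c z - abscissa c p) / (abscissa c q - abscissa c p)
  have : abscissa c ((1 - θ) • p + θ • q) =
      abscissa c p + θ * (abscissa c q - abscissa c p) := by
    simp only [abscissa, PiLp.add_apply, PiLp.smul_apply, smul_eq_mul]; ring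
  rw [this, e₂]
  ring

theorem exists_point (c t s : ℝ) : ∃ z : Plane, abscissa c z = t ∧ z 1 = s :=
  ⟨!₂[t - c * s, s], by simp [abscissa], by simp⟩

/-- A segment contact representation with a shear of the plane after which distinct endpoints of
segments have distinct abscissas, and the first endpoint of each segment is on the left. -/
structure OrientedRepresentation {V : Type u} (G : SimpleGraph V) extends
    SegmentContactRepresentation G where
  /-- the parameter of the shear -/
  shear : ℝ
  abscissa_le : ∀ v, abscissa shear (p v) ≤ abscissa shear (q v)
  injOn_abscissa : Set.InjOn (abscissa shear) (Set.range p ∪ Set.range q)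

theorem SegmentContactRepresentation.nonempty_orientedRepresentation {V : Type u} [Finite V]
    {G : SimpleGraph V} (ρ : SegmentContactRepresentation G) :
    Nonempty (OrientedRepresentation G) := by
  obtain ⟨c, hc⟩ := exists_injOn_abscissa ((Set.finite_range ρ.p).union (Set.finite_range ρ.q))
  have key : ∀ v, ∃ e : Plane × Plane, segment ℝ e.1 e.2 = segment ℝ (ρ.p v) (ρ.q v) ∧
      (∀ z, z = e.1 ∨ z = e.2 ↔ z = ρ.p v ∨ z = ρ.q v) ∧ abscissa c e.1 ≤ abscissa c e.2 := by
    intro v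
    rcases le_total (abscissa c (ρ.p v)) (abscissa c (ρ.q v)) with h | h
    · exact ⟨(ρ.p v, ρ.q v), rfl, fun _ => Iff.rfl, h⟩
    · exact ⟨(ρ.q v, ρ.p v), segment_symm ℝ _ _, fun _ => or_comm, h⟩
  choose e he₁ he₂ he₃ using key
  have mem : ∀ v z, z = (e v).1 ∨ z = (e v).2 → z ∈ Set.range ρ.p ∪ Set.range ρ.q := by
    intro v z hz
    rcases (he₂ v z).1 hz with rfl | rfl
    exacts [.inl ⟨v, rfl⟩, .inr ⟨v, rfl⟩]
  exact ⟨{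
    p := fun v => (e v).1
    q := fun v => (e v).2
    adj_iff := fun u v h => by rw [he₁, he₁]; exact ρ.adj_iff u v h
    contact := fun u v h x hu hv => by
      rw [he₁] at hu hv
      rw [he₂, he₂]
      exact ρ.contact u v h x hu hv
    shear := c
    abscissa_le := he₃
    injOn_abscissa := hc.mono (by
      rintro z (⟨v, rfl⟩ | ⟨v, rfl⟩)
      exacts [mem v _ (.inl rfl), mem v _ (.inr rfl)]) }⟩

/-! ### From contact representations to arrangements -/

namespace OrientedRepresentation

open Classical

variable {V : Type u} {G : SimpleGraph V} (ρ : OrientedRepresentation G) (X : Finset V)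

/-- The segment of a vertex. -/
def seg (v : V) : Set Plane := segment ℝ (ρ.p v) (ρ.q v)

/-- The point `z` is an endpoint of the segment of `v`. -/
def IsEnd (v : V) (z : Plane) : Prop := z = ρ.p v ∨ z = ρ.q v

/-- The point `z` is a tip: an endpoint of the segment of a vertex of `X`. -/
def IsTip (z : Plane) : Prop := ∃ x ∈ X, ρ.IsEnd x z

/-- The vertices of `X` whose segments contain the point `z`. -/
def trace (z : Plane) : Set V := {x | x ∈ X ∧ z ∈ ρ.seg x}

/-- The relative interior of the segment of `v` contains a tip. -/
def IsPierced (v : V) : Prop := ∃ z, ρ.IsTip X z ∧ z ∈ ρ.seg v ∧ ¬ ρ.IsEnd v z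

/-- The kind of a point of the union of the segments of `X`. The value at a point outside this
union is irrelevant. -/
noncomputable def kind (z : Plane) : PointKind V :=
  if h : (ρ.trace X z).Nonempty ∧ ¬ ρ.IsTip X z then .interior h.1.some
  else .tip (abscissa ρ.shear z)

variable {ρ X}

theorem IsEnd.mem_seg {v : V} {z : Plane} (h : ρ.IsEnd v z) : z ∈ ρ.seg v := by
  rcases h with rfl | rfl
  exacts [left_mem_segment ℝ _ _, right_mem_segment ℝ _ _]

theorem isEnd_left (v : V) : ρ.IsEnd v (ρ.p v) := .inl rfl

theorem isEnd_right (v : V) : ρ.IsEnd v (ρ.q v) := .inr rfl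

theorem IsEnd.eq {u v : V} {z w : Plane} (hz : ρ.IsEnd u z) (hw : ρ.IsEnd v w)
    (h : abscissa ρ.shear z = abscissa ρ.shear w) : z = w := by
  refine ρ.injOn_abscissa ?_ ?_ h
  · rcases hz with rfl | rfl
    exacts [.inl ⟨_, rfl⟩, .inr ⟨_, rfl⟩]
  · rcases hw with rfl | rfl
    exacts [.inl ⟨_, rfl⟩, .inr ⟨_, rfl⟩]

theorem isEnd_or_isEnd {u v : V} (h : u ≠ v) {z : Plane} (hu : z ∈ ρ.seg u) (hv : z ∈ ρ.seg v) :
    ρ.IsEnd u z ∨ ρ.IsEnd v z :=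
  ρ.contact u v h z hu hv

theorem abscissa_lt {v : V} (h : ρ.p v ≠ ρ.q v) :
    abscissa ρ.shear (ρ.p v) < abscissa ρ.shear (ρ.q v) :=
  lt_of_le_of_ne (ρ.abscissa_le v) fun h' => h ((isEnd_left v).eq (isEnd_right v) h')

/-- A segment of `X` through a point that is not a tip is the only one. -/
theorem trace_eq_singleton {z : Plane} (hz : ¬ ρ.IsTip X z) {x : V} (hx : x ∈ ρ.trace X z) :
    ρ.trace X z = {x} := by
  refine Set.eq_singleton_iff_unique_mem.2 ⟨hx, fun y hy => ?_⟩
  by_contra h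
  rcases isEnd_or_isEnd h hy.2 hx.2 with h' | h'
  exacts [hz ⟨y, hy.1, h'⟩, hz ⟨x, hx.1, h'⟩]

theorem kind_of_isTip {z : Plane} (hz : ρ.IsTip X z) :
    ρ.kind X z = .tip (abscissa ρ.shear z) :=
  dif_neg fun h => h.2 hz

theorem exists_kind_eq_interior {z : Plane} (hz : ¬ ρ.IsTip X z) (h : (ρ.trace X z).Nonempty) :
    ∃ x ∈ ρ.trace X z, ρ.kind X z = .interior x :=
  ⟨_, Set.Nonempty.some_mem h, dif_pos ⟨h, hz⟩⟩

variable (ρ X) in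
/-- The vertices of `X` whose segments contain a point of a given kind. -/
def kindTrace : PointKind V → Set V
  | .interior x => {x}
  | .tip t => {x | x ∈ X ∧ ∃ z ∈ ρ.seg x, ρ.IsTip X z ∧ abscissa ρ.shear z = t}

theorem kindTrace_kind {z : Plane} (h : (ρ.trace X z).Nonempty) :
    ρ.kindTrace X (ρ.kind X z) = ρ.trace X z := by
  by_cases hz : ρ.IsTip X z
  · rw [kind_of_isTip hz]
    ext x
    refine ⟨?_, fun hx => ⟨hx.1, z, hx.2, hz, rfl⟩⟩
    rintro ⟨hx, w, hw, ⟨y, -, hwy⟩, hwz⟩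
    obtain ⟨y', -, hzy'⟩ := hz
    exact ⟨hx, hwy.eq hzy' hwz ▸ hw⟩
  · obtain ⟨x, hx, hk⟩ := exists_kind_eq_interior hz h
    rw [hk, trace_eq_singleton hz hx]
    rfl

variable (ρ X) in
/-- The vertices outside `X` whose segments join two points of different kinds without
passing through a tip. -/
def IsConnector (v : V) : Prop :=
  v ∉ X ∧ ¬ ρ.IsPierced X v ∧ (ρ.trace X (ρ.p v)).Nonempty ∧ (ρ.trace X (ρ.q v)).Nonempty ∧
    ρ.kind X (ρ.p v) ≠ ρ.kind X (ρ.q v)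

theorem IsConnector.ne {v : V} (h : ρ.IsConnector X v) : ρ.p v ≠ ρ.q v :=
  fun h' => h.2.2.2.2 (h' ▸ rfl)

theorem IsConnector.nonempty_trace {v : V} (h : ρ.IsConnector X v) {z : Plane}
    (hz : ρ.IsEnd v z) : (ρ.trace X z).Nonempty := by
  rcases hz with rfl | rfl
  exacts [h.2.2.1, h.2.2.2.1]

/-- The height of the segment of a vertex over the axis of abscissas. -/
noncomputable def height (ρ : OrientedRepresentation G) (v : V) : ℝ → ℝ :=
  lineHeight ρ.shear (ρ.p v) (ρ.q v)

theorem IsEnd.abscissa_eq {v : V} {z : Plane} (h : ρ.IsEnd v z) :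
    abscissa ρ.shear z = abscissa ρ.shear (ρ.p v) ∨
      abscissa ρ.shear z = abscissa ρ.shear (ρ.q v) := by
  rcases h with rfl | rfl
  exacts [.inl rfl, .inr rfl]

theorem exists_mem_seg_of_height_eq {u v : V} (hu : ρ.p u ≠ ρ.q u) (hv : ρ.p v ≠ ρ.q v) {t : ℝ}
    (h₁ : abscissa ρ.shear (ρ.p u) ≤ t) (h₂ : t ≤ abscissa ρ.shear (ρ.q u))
    (h₃ : abscissa ρ.shear (ρ.p v) ≤ t) (h₄ : t ≤ abscissa ρ.shear (ρ.q v))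
    (h : ρ.height u t = ρ.height v t) :
    ∃ z, abscissa ρ.shear z = t ∧ z ∈ ρ.seg u ∧ z ∈ ρ.seg v := by
  obtain ⟨z, rfl, hz⟩ := exists_point ρ.shear t (ρ.height u t)
  exact ⟨z, rfl, mem_segment_of_lineHeight (abscissa_lt hu) h₁ h₂ hz.symm,
    mem_segment_of_lineHeight (abscissa_lt hv) h₃ h₄ (hz.trans h).symm⟩

theorem exists_isEnd {v : V} (hv : ρ.p v ≠ ρ.q v) {t : ℝ}
    (ht : t = abscissa ρ.shear (ρ.p v) ∨ t = abscissa ρ.shear (ρ.q v)) :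
    ∃ z, ρ.IsEnd v z ∧ abscissa ρ.shear z = t ∧ ρ.height v t = z 1 := by
  rcases ht with rfl | rfl
  · exact ⟨_, isEnd_left v, rfl, lineHeight_left _ _ _⟩
  · exact ⟨_, isEnd_right v, rfl, lineHeight_right (abscissa_lt hv)⟩

variable (ρ X) in
/-- The abscissas of the tips. -/
noncomputable def tipAbscissas : Finset ℝ :=
  X.image (fun x => abscissa ρ.shear (ρ.p x)) ∪ X.image (fun x => abscissa ρ.shear (ρ.q x))

theorem mem_tipAbscissas {v : V} {z : Plane} (hz : ρ.IsEnd v z) :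
    abscissa ρ.shear z ∈ ρ.tipAbscissas X ↔ ρ.IsTip X z := by
  simp only [tipAbscissas, Finset.mem_union, Finset.mem_image]
  constructor
  · rintro (⟨x, hx, h⟩ | ⟨x, hx, h⟩)
    · exact ⟨x, hx, hz.eq (isEnd_left x) h.symm ▸ isEnd_left x⟩
    · exact ⟨x, hx, hz.eq (isEnd_right x) h.symm ▸ isEnd_right x⟩
  · rintro ⟨x, hx, rfl | rfl⟩
    exacts [.inl ⟨x, hx, rfl⟩, .inr ⟨x, hx, rfl⟩]

/-- An end of a connector is a tip or lies in the relative interior of an obstacle. -/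
theorem IsConnector.kind_spec {v : V} (hv : ρ.IsConnector X v) {z : Plane} (hz : ρ.IsEnd v z) :
    (abscissa ρ.shear z ∈ ρ.tipAbscissas X ∧ ρ.kind X z = .tip (abscissa ρ.shear z)) ∨
      (abscissa ρ.shear z ∉ ρ.tipAbscissas X ∧
        ∃ x ∈ X.filter fun x => ρ.p x ≠ ρ.q x, ρ.kind X z = .interior x ∧
          abscissa ρ.shear (ρ.p x) < abscissa ρ.shear z ∧
          abscissa ρ.shear z < abscissa ρ.shear (ρ.q x) ∧
          ρ.height x (abscissa ρ.shear z) = ρ.height v (abscissa ρ.shear z)) := by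
  rw [mem_tipAbscissas hz]
  by_cases htip : ρ.IsTip X z
  · exact .inl ⟨htip, kind_of_isTip htip⟩
  · obtain ⟨x, ⟨hx, hzx⟩, hk⟩ := exists_kind_eq_interior htip (hv.nonempty_trace hz)
    have hne : ρ.p x ≠ ρ.q x := fun h => by
      rw [seg, ← h, segment_same] at hzx
      exact htip ⟨x, hx, .inl hzx⟩
    have hmem := abscissa_mem_Icc_of_mem_segment (ρ.abscissa_le x) hzx
    refine .inr ⟨htip, x, Finset.mem_filter.2 ⟨hx, hne⟩, hk,
      lt_of_le_of_ne hmem.1 fun h => ?_, lt_of_le_of_ne hmem.2 fun h => ?_, ?_⟩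
    · exact htip ⟨x, hx, hz.eq (isEnd_left x) h.symm ▸ isEnd_left x⟩
    · exact htip ⟨x, hx, hz.eq (isEnd_right x) h ▸ isEnd_right x⟩
    · rw [height, height, lineHeight_of_mem_segment (abscissa_lt hne) hzx,
        lineHeight_of_mem_segment (abscissa_lt hv.ne) hz.mem_seg]

variable (ρ X) in
/-- The segments of positive length of the vertices of `X` as obstacles, with the connectors. -/
noncomputable def arrangement [Fintype V] : Arrangement V where
  obstacles := X.filter fun x => ρ.p x ≠ ρ.q x
  connectors := Finset.univ.filter fun v => ρ.IsConnector X v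
  left v := abscissa ρ.shear (ρ.p v)
  right v := abscissa ρ.shear (ρ.q v)
  height := ρ.height
  tips := ρ.tipAbscissas X
  leftKind v := ρ.kind X (ρ.p v)
  rightKind v := ρ.kind X (ρ.q v)
  disjoint_obstacles_connectors := Finset.disjoint_left.2 fun x hx hx' =>
    (Finset.mem_filter.1 hx').2.1 (Finset.mem_filter.1 hx).1
  left_lt_right o ho := by
    rcases Finset.mem_union.1 ho with h | h
    exacts [abscissa_lt (Finset.mem_filter.1 h).2, abscissa_lt (Finset.mem_filter.1 h).2.ne]
  continuous_height o := continuous_lineHeight _ _ _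
  height_ne o ho o' ho' hne t h₁ h₂ h₃ h₄ h := by
    have ne : ∀ o ∈ (X.filter fun x => ρ.p x ≠ ρ.q x) ∪
        Finset.univ.filter fun v => ρ.IsConnector X v, ρ.p o ≠ ρ.q o := fun o ho => by
      rcases Finset.mem_union.1 ho with h | h
      exacts [(Finset.mem_filter.1 h).2, (Finset.mem_filter.1 h).2.ne]
    obtain ⟨z, rfl, hz, hz'⟩ :=
      exists_mem_seg_of_height_eq (ne o ho) (ne o' ho') h₁.le h₂.le h₃.le h₄.le h
    rcases isEnd_or_isEnd hne hz hz' with h | h <;> rcases h.abscissa_eq with h | h <;> linarith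
  height_eq_of_ends o ho o' ho' t ht ht' := by
    have ne : ∀ o ∈ (X.filter fun x => ρ.p x ≠ ρ.q x) ∪
        Finset.univ.filter fun v => ρ.IsConnector X v, ρ.p o ≠ ρ.q o := fun o ho => by
      rcases Finset.mem_union.1 ho with h | h
      exacts [(Finset.mem_filter.1 h).2, (Finset.mem_filter.1 h).2.ne]
    obtain ⟨z, hz, hzt, h⟩ := exists_isEnd (ne o ho) ht
    obtain ⟨z', hz', hzt', h'⟩ := exists_isEnd (ne o' ho') ht'
    rw [h, h', hz.eq hz' (hzt.trans hzt'.symm)]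
  connector_height_ne v hv o ho hne t h₁ h₂ h₃ h₄ h := by
    have hv := (Finset.mem_filter.1 hv).2
    have ne : ρ.p o ≠ ρ.q o := by
      rcases Finset.mem_union.1 ho with h | h
      exacts [(Finset.mem_filter.1 h).2, (Finset.mem_filter.1 h).2.ne]
    obtain ⟨z, rfl, hz, hz'⟩ := exists_mem_seg_of_height_eq hv.ne ne h₁.le h₂.le h₃ h₄ h
    have hzv : ¬ ρ.IsEnd v z := fun h => by
      rcases h.abscissa_eq with h | h <;> linarith
    have hzo := (isEnd_or_isEnd hne.symm hz hz').resolve_left hzv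
    -- The point `z` is a tip: if it is an end of a connector, then a segment of `X`
    -- contains it, and this segment has to end there.
    refine hv.2.1 ⟨z, ?_, hz, hzv⟩
    rcases Finset.mem_union.1 ho with h | h
    · exact ⟨o, (Finset.mem_filter.1 h).1, hzo⟩
    · obtain ⟨x, hx, hzx⟩ := (Finset.mem_filter.1 h).2.nonempty_trace hzo
      have hvx : v ≠ x := fun h => hv.1 (h ▸ hx)
      exact ⟨x, hx, (isEnd_or_isEnd hvx hz hzx).resolve_left hzv⟩
  mem_tips x hx :=
    have hx := (Finset.mem_filter.1 hx).1
    ⟨(mem_tipAbscissas (isEnd_left x)).2 ⟨x, hx, isEnd_left x⟩,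
      (mem_tipAbscissas (isEnd_right x)).2 ⟨x, hx, isEnd_right x⟩⟩
  leftKind_spec v hv := (Finset.mem_filter.1 hv).2.kind_spec (isEnd_left v)
  rightKind_spec v hv := (Finset.mem_filter.1 hv).2.kind_spec (isEnd_right v)
  leftKind_ne_rightKind v hv := (Finset.mem_filter.1 hv).2.2.2.2.2

/-! ### Counting neighborhoods -/

/-- A segment that is not pierced meets the segments of `X` in its ends only. -/
theorem neighborSet_inter_eq {v : V} (hv : v ∉ X) (hp : ¬ ρ.IsPierced X v) :
    G.neighborSet v ∩ X = ρ.trace X (ρ.p v) ∪ ρ.trace X (ρ.q v) := by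
  ext x
  constructor
  · rintro ⟨hadj, hx : x ∈ X⟩
    have hvx : v ≠ x := fun h => hv (h ▸ hx)
    obtain ⟨z, hzv, hzx⟩ := (ρ.adj_iff v x hvx).1 hadj
    have hz : ρ.IsEnd v z := by
      by_contra h
      exact hp ⟨z, ⟨x, hx, (isEnd_or_isEnd hvx hzv hzx).resolve_left h⟩, hzv, h⟩
    rcases hz with rfl | rfl
    exacts [.inl ⟨hx, hzx⟩, .inr ⟨hx, hzx⟩]
  · rintro (⟨hx, h⟩ | ⟨hx, h⟩)
    · exact ⟨(ρ.adj_iff v x fun h => hv (h ▸ hx)).2 ⟨_, (isEnd_left v).mem_seg, h⟩, hx⟩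
    · exact ⟨(ρ.adj_iff v x fun h => hv (h ▸ hx)).2 ⟨_, (isEnd_right v).mem_seg, h⟩, hx⟩

variable (ρ X) in
/-- The possible traces of points. -/
noncomputable def pointTraces : Finset (Set V) :=
  insert ∅ (X.image (fun x => {x}) ∪ (X.image (fun x => ρ.trace X (ρ.p x)) ∪
    X.image (fun x => ρ.trace X (ρ.q x))))

theorem card_pointTraces_le : (ρ.pointTraces X).card ≤ 3 * X.card + 1 := by
  unfold pointTraces
  have h₁ := Finset.card_insert_le ∅ (X.image (fun x => ({x} : Set V)) ∪
    (X.image (fun x => ρ.trace X (ρ.p x)) ∪ X.image (fun x => ρ.trace X (ρ.q x))))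
  have h₂ := Finset.card_union_le (X.image (fun x => ({x} : Set V)))
    (X.image (fun x => ρ.trace X (ρ.p x)) ∪ X.image (fun x => ρ.trace X (ρ.q x)))
  have h₃ := Finset.card_union_le (X.image (fun x => ρ.trace X (ρ.p x)))
    (X.image (fun x => ρ.trace X (ρ.q x)))
  have h₄ := Finset.card_image_le (s := X) (f := fun x => ({x} : Set V))
  have h₅ := Finset.card_image_le (s := X) (f := fun x => ρ.trace X (ρ.p x))
  have h₆ := Finset.card_image_le (s := X) (f := fun x => ρ.trace X (ρ.q x))
  omega

theorem trace_mem_pointTraces (z : Plane) : ρ.trace X z ∈ ρ.pointTraces X := by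
  simp only [pointTraces, Finset.mem_insert, Finset.mem_union, Finset.mem_image]
  by_cases hz : ρ.IsTip X z
  · obtain ⟨x, hx, rfl | rfl⟩ := hz
    exacts [.inr (.inr (.inl ⟨x, hx, rfl⟩)), .inr (.inr (.inr ⟨x, hx, rfl⟩))]
  · rcases (ρ.trace X z).eq_empty_or_nonempty with h | ⟨x, hx⟩
    · exact .inl h
    · exact .inr (.inl ⟨x, hx.1, (trace_eq_singleton hz hx).symm⟩)

/-- A tip lies in the relative interior of at most one segment. -/
theorem card_isPierced_le [Fintype V] :
    (Finset.univ.filter fun v => ρ.IsPierced X v).card ≤ 2 * X.card := by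
  have hcard : (X.image ρ.p ∪ X.image ρ.q).card ≤ 2 * X.card := by
    have h₁ := Finset.card_union_le (X.image ρ.p) (X.image ρ.q)
    have h₂ := Finset.card_image_le (s := X) (f := ρ.p)
    have h₃ := Finset.card_image_le (s := X) (f := ρ.q)
    omega
  refine le_trans ?_ hcard
  have hex : ∀ v, ∃ z, ρ.IsPierced X v → ρ.IsTip X z ∧ z ∈ ρ.seg v ∧ ¬ ρ.IsEnd v z := fun v => by
    by_cases h : ρ.IsPierced X v
    · exact ⟨h.choose, fun _ => h.choose_spec⟩
    · exact ⟨ρ.p v, fun h' => absurd h' h⟩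
  choose z hz using hex
  refine Finset.card_le_card_of_injOn z (fun v hv => ?_) fun u hu v hv h => ?_
  · obtain ⟨⟨x, hx, h⟩, -⟩ := hz v (Finset.mem_filter.1 hv).2
    rw [Finset.mem_coe, Finset.mem_union, Finset.mem_image, Finset.mem_image]
    rcases h with h | h
    exacts [.inl ⟨x, hx, h.symm⟩, .inr ⟨x, hx, h.symm⟩]
  · obtain ⟨-, hu₁, hu₂⟩ := hz u (Finset.mem_filter.1 hu).2
    obtain ⟨-, hv₁, hv₂⟩ := hz v (Finset.mem_filter.1 hv).2
    by_contra hne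
    rcases isEnd_or_isEnd hne hu₁ (h ▸ hv₁) with h' | h'
    exacts [hu₂ h', hv₂ (h ▸ h')]

/-- The bound for arrangements, in terms of `X`: there are at most `|X|` obstacles and `2 |X|`
tips. -/
theorem card_kinds_le [Fintype V] :
    ((Finset.univ.filter fun v => ρ.IsConnector X v).image
      fun v => s(ρ.kind X (ρ.p v), ρ.kind X (ρ.q v))).card ≤ 23 * X.card := by
  have h := (ρ.arrangement X).card_image_kinds_le
  have h₁ : (ρ.arrangement X).obstacles.card ≤ X.card := Finset.card_filter_le _ _
  have h₂ : (ρ.arrangement X).tips.card ≤ 2 * X.card := by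
    have h₁ := Finset.card_union_le (X.image fun x => abscissa ρ.shear (ρ.p x))
      (X.image fun x => abscissa ρ.shear (ρ.q x))
    have h₂ := Finset.card_image_le (s := X) (f := fun x => abscissa ρ.shear (ρ.p x))
    have h₃ := Finset.card_image_le (s := X) (f := fun x => abscissa ρ.shear (ρ.q x))
    exact h₁.trans (by omega)
  have h₃ : ((Finset.univ.filter fun v => ρ.IsConnector X v).image
      fun v => s(ρ.kind X (ρ.p v), ρ.kind X (ρ.q v))) =
        (ρ.arrangement X).connectors.image
          fun v => s((ρ.arrangement X).leftKind v, (ρ.arrangement X).rightKind v) := rfl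
  rw [h₃]
  omega

/-- The traces of the vertices of `X`, of the pierced vertices, of the vertices whose trace is that
of a single point, and of the connectors are bounded separately. -/
theorem ncard_range_neighborSet_inter_le [Finite V] (ρ : OrientedRepresentation G)
    (X : Finset V) :
    (Set.range fun v => G.neighborSet v ∩ X).ncard ≤ 29 * X.card + 1 := by
  cases nonempty_fintype V
  set N : V → Set V := fun v => G.neighborSet v ∩ X with hN
  set pairs := (Finset.univ.filter fun v => ρ.IsConnector X v).image
    fun v => s(ρ.kind X (ρ.p v), ρ.kind X (ρ.q v)) with hpairs
  set decode : Sym2 (PointKind V) → Set V := fun e => {x | ∃ k ∈ e, x ∈ ρ.kindTrace X k}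
    with hdecode
  set S₁ := X.image N
  set S₂ := (Finset.univ.filter fun v => ρ.IsPierced X v).image N with hS₂
  set S₃ := ρ.pointTraces X
  set S₄ := pairs.image decode with hS₄
  have hsub : Set.range N ⊆ ((S₁ ∪ S₂) ∪ (S₃ ∪ S₄) : Finset (Set V)) := by
    rintro _ ⟨v, rfl⟩
    rw [Finset.mem_coe, Finset.mem_union, Finset.mem_union, Finset.mem_union]
    by_cases hv : v ∈ X
    · exact .inl (.inl (Finset.mem_image_of_mem _ hv))
    by_cases hp : ρ.IsPierced X v
    · exact .inl (.inr (Finset.mem_image_of_mem _ (Finset.mem_filter.2 ⟨Finset.mem_univ _, hp⟩)))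
    right
    have hNv : N v = ρ.trace X (ρ.p v) ∪ ρ.trace X (ρ.q v) := neighborSet_inter_eq hv hp
    rcases (ρ.trace X (ρ.p v)).eq_empty_or_nonempty with h₁ | h₁
    · left; rw [hNv, h₁, Set.empty_union]; exact trace_mem_pointTraces _
    rcases (ρ.trace X (ρ.q v)).eq_empty_or_nonempty with h₂ | h₂
    · left; rw [hNv, h₂, Set.union_empty]; exact trace_mem_pointTraces _
    by_cases hk : ρ.kind X (ρ.p v) = ρ.kind X (ρ.q v)
    · left
      rw [hNv, ← kindTrace_kind h₁, hk, kindTrace_kind h₂, Set.union_self]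
      exact trace_mem_pointTraces _
    · right
      refine Finset.mem_image.2 ⟨_, Finset.mem_image_of_mem _ (Finset.mem_filter.2
        ⟨Finset.mem_univ v, hv, hp, h₁, h₂, hk⟩), ?_⟩
      rw [hNv, hdecode]
      ext x
      simp [kindTrace_kind h₁, kindTrace_kind h₂]
  have h₀ := Set.ncard_le_ncard hsub (Finset.finite_toSet _)
  rw [Set.ncard_coe_finset] at h₀
  have h₁ : S₁.card ≤ X.card := Finset.card_image_le
  have h₂ : S₂.card ≤ 2 * X.card := Finset.card_image_le.trans card_isPierced_le
  have h₃ : S₃.card ≤ 3 * X.card + 1 := card_pointTraces_le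
  have h₄ : S₄.card ≤ 23 * X.card := Finset.card_image_le.trans card_kinds_le
  have h₅ := Finset.card_union_le (S₁ ∪ S₂) (S₃ ∪ S₄)
  have h₆ := Finset.card_union_le S₁ S₂
  have h₇ := Finset.card_union_le S₃ S₄
  omega

end OrientedRepresentation

theorem mainTheorem12 : HasLinearNeighborhoodComplexity.{u} IsContactSegmentGraph.{u} := by
  refine ⟨30, fun V _ G ⟨ρ⟩ X hX => ?_⟩
  obtain ⟨ρ'⟩ := ρ.nonempty_orientedRepresentation
  have h := ρ'.ncard_range_neighborSet_inter_le X.toFinite.toFinset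
  rw [← Set.ncard_eq_toFinset_card X, Set.Finite.coe_toFinset] at h
  have hpos : 0 < X.ncard := (Set.ncard_pos).2 hX
  have : (Set.range fun v : V => G.neighborSet v ∩ X).ncard ≤ 30 * X.ncard := by omega
  exact_mod_cast this
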